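/- Let $X$ be a locally path connected topological space, let $x_0\in X$, and let $H$ be a subgroup of $\pi_1(X,x_0)$. Then $H$ is a semicovering subgroup of $\pi_1(X,x_0)$ if and only if $H$ is open in $\pi_1^{\mathrm{pSpan}}(X,x_0)$. Here the terms have the following meaning. A *semicovering map* is a continuous surjective local homeomorphism $p:\widetilde X\to X$ with the unique path lifting property: for every $\tilde x\in\widetilde X$ and every path $\gamma:[0,1]\to X$ with $\gamma(0)=p(\tilde x)$ there is exactly one path $\tilde\gamma:[0,1]\to\widetilde X$ with $\tilde\gamma(0)=\tilde x$ and $p\circ\tilde\gamma=\gamma$. (Neither $X$ nor $\widetilde X$ is required to be connected.) The subgroup $H$ is a *semicovering subgroup* if there are a semicovering map $p:\widetilde X\to X$ and a point $\tilde x_0\in p^{-1}(x_0)$ with $H=p_*\pi_1(\widetilde X,\tilde x_0)$. A *path open cover* $\mathcal V$ at $x_0$ is a family $\{V_\alpha\}$, indexed by all paths $\alpha$ in $X$ starting at $x_0$, of open sets $V_\alpha\subseteq X$ with $\alpha(1)\in V_\alpha$. Its *path Spanier subgroup* $\widetilde\pi(\mathcal V,x_0)\le\pi_1(X,x_0)$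 consists of all classes of the form $\left[\prod_{j=1}^{n}\alpha_j*\beta_j*\alpha_j^{-1}\right]$, where each $\alpha_j$ is a path starting at $x_0$ and each $\beta_j$ is a loop in $V_{\alpha_j}$ based at $\alpha_j(1)$. Finally, $\pi_1^{\mathrm{pSpan}}(X,x_0)$ is $\pi_1(X,x_0)$ with the *path Spanier topology*, the topology having as a basis all left cosets $[\gamma]\,\widetilde\pi(\mathcal V,x_0)$, where $[\gamma]\in\pi_1(X,x_0)$ and $\mathcal V$ is a path open cover at $x_0$. -/

import Mathlib

open scoped unitInterval Topology

universe u

/-- Existence and uniqueness of lifts of paths with prescribed initial point. -/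
def HasUniquePathLifting {E X : Type u} [TopologicalSpace E] [TopologicalSpace X]
    (p : E → X) : Prop :=
  ∀ (e : E) (γ : C(I, X)), γ 0 = p e → ∃! Γ : C(I, E), Γ 0 = e ∧ p ∘ Γ = γ

/-- A semicovering map: a continuous surjective local homeomorphism with the unique path
lifting property. -/
structure IsSemicoveringMap {E X : Type u} [TopologicalSpace E] [TopologicalSpace X]
    (p : C(E, X)) : Prop where
  surjective : Function.Surjective p
  isLocalHomeomorph : IsLocalHomeomorph p
  uniquePathLifting : HasUniquePathLifting p

/-- `H ≤ π₁(X, x₀)` is a semicovering subgroup if it is the image `p_* π₁(E, e₀)` for some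
semicovering map `p : (E, e₀) → (X, x₀)`. -/
def IsSemicoveringSubgroup {X : Type u} [TopologicalSpace X] {x₀ : X}
    (H : Subgroup (FundamentalGroup X x₀)) : Prop :=
  ∃ (E : Type u) (_ : TopologicalSpace E) (p : C(E, X)) (e₀ : E) (h : p e₀ = x₀),
    IsSemicoveringMap p ∧ (FundamentalGroup.mapOfEq p h).range = H

/-- A path open cover at `x₀`: to each path `α` starting at `x₀` (and ending at some point `x`)
it assigns an open neighbourhood `V_α` of the endpoint of `α`. -/
structure PathOpenCover (X : Type u) [TopologicalSpace X] (x₀ : X) where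
  nhd : ∀ {x : X}, Path x₀ x → Set X
  isOpen_nhd : ∀ {x : X} (α : Path x₀ x), IsOpen (nhd α)
  endpoint_mem : ∀ {x : X} (α : Path x₀ x), x ∈ nhd α

/-- The path Spanier subgroup of the path open cover `V`: it is generated by the classes of
`α * β * α⁻¹`, where `α` is a path starting at `x₀` and `β` is a loop inside `V_α` based at the
endpoint of `α`. (The inverse of such a class is again one of them, with `β⁻¹` in place of `β`,
so the elements are exactly the finite products of such classes.) -/
noncomputable def pathSpanierSubgroup {X : Type u} [TopologicalSpace X] {x₀ : X} (V : PathOpenCover X x₀) :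
    Subgroup (FundamentalGroup X x₀) :=
  Subgroup.closure
    {g | ∃ (x : X) (α : Path x₀ x) (β : Path x x), Set.range β ⊆ V.nhd α ∧
      g = FundamentalGroup.fromPath
        (Path.Homotopic.Quotient.mk ((α.trans β).trans α.symm))}

/-- The left coset `[g] S = {[g * s] : [s] ∈ S}` with respect to concatenation of loops, "first
`g`, then `s`". (Multiplication in Mathlib's `FundamentalGroup` is concatenation in the
opposite order, so the coset is spelled out through `trans`.) -/
def concatLeftCoset {X : Type u} [TopologicalSpace X] {x₀ : X} (g : FundamentalGroup X x₀)
    (S : Subgroup (FundamentalGroup X x₀)) : Set (FundamentalGroup X x₀) :=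
  {q | ∃ s ∈ S, q = FundamentalGroup.fromPath (g.toPath.trans s.toPath)}

/-- The subgroup topology on `π₁(X, x₀)` determined by a family `F` of subgroups: the topology
generated by all left cosets of members of `F`. -/
@[reducible]
def subgroupTopology {X : Type u} [TopologicalSpace X] {x₀ : X}
    (F : Set (Subgroup (FundamentalGroup X x₀))) : TopologicalSpace (FundamentalGroup X x₀) :=
  TopologicalSpace.generateFrom
    {B | ∃ (g : FundamentalGroup X x₀) (S : Subgroup (FundamentalGroup X x₀)),
      S ∈ F ∧ B = concatLeftCoset g S}

/-- The path Spanier topology: the subgroup topology determined by the family of all path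
Spanier subgroups. -/
@[reducible]
def pathSpanierTopology (X : Type u) [TopologicalSpace X] (x₀ : X) :
    TopologicalSpace (FundamentalGroup X x₀) :=
  subgroupTopology (Set.range (pathSpanierSubgroup (X := X) (x₀ := x₀)))

open Set Path

/-! ### Path transports and their total spaces -/

/-! Both conditions say that `H` contains the path Spanier subgroup of some path open cover. For
openness this holds because intersecting two covers shrinks both subgroups, so the cosets form a
basis. If `p` is a semicovering with image `H`, lift each `α` and let `V_α` be an evenly mapped
neighbourhood at the end of the lift. Loops in `V_α` then lift to loops there, so `α * β * α⁻¹`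
lifts to a loop. Conversely, paths act on the `H`-cosets of path classes from `x₀`. If `H` contains
a path Spanier subgroup, small loops fix each coset (`LocallyFixed`). This makes the space of
cosets, topologized by sheets, a semicovering: sheets project injectively, and lifts are transports
(`continuous_lift_iff`). Its image on `π₁` is the stabilizer of the coset `H`, namely `H`. -/

/-- A functorial action of homotopy classes of paths of `X` on a family of fibers. -/
structure PathTransport (X : Type u) [TopologicalSpace X] where
  /-- The fiber over a point. -/
  fiber : X → Type u
  /-- Transport along a homotopy class of paths. -/
  act : ∀ {x y : X}, fiber x → Homotopic.Quotient x y → fiber y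
  act_refl : ∀ {x : X} (c : fiber x), act c (Homotopic.Quotient.refl x) = c
  act_trans : ∀ {x y z : X} (c : fiber x) (p : Homotopic.Quotient x y)
    (q : Homotopic.Quotient y z), act c (p.trans q) = act (act c p) q

namespace PathTransport

variable {X : Type u} [TopologicalSpace X] (T : PathTransport X)

/-- The total space of a path transport. -/
structure Total : Type u where
  /-- The underlying point of the base. -/
  base : X
  /-- The point of the fiber. -/
  coord : T.fiber base

variable {T}

/-- The points of the total space reached from `c` by transport along paths inside `U`. -/
def sheet {x : X} (c : T.fiber x) (U : Set X) : Set T.Total :=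
  {e | ∃ (y : X) (γ : Path x y), range γ ⊆ U ∧ e = ⟨y, T.act c (Homotopic.Quotient.mk γ)⟩}

theorem sheet_mono {x : X} (c : T.fiber x) {U V : Set X} (h : U ⊆ V) : sheet c U ⊆ sheet c V := by
  rintro _ ⟨y, γ, hγ, rfl⟩
  exact ⟨y, γ, hγ.trans h, rfl⟩

theorem mem_sheet_self {x : X} (c : T.fiber x) {U : Set X} (hx : x ∈ U) :
    (⟨x, c⟩ : T.Total) ∈ sheet c U :=
  ⟨x, Path.refl x, by simpa using hx, by rw [Homotopic.Quotient.mk_refl, T.act_refl]⟩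

theorem sheet_act_subset {x y : X} (c : T.fiber x) {U : Set X} (γ : Path x y)
    (hγ : range γ ⊆ U) : sheet (T.act c (Homotopic.Quotient.mk γ)) U ⊆ sheet c U := by
  rintro _ ⟨z, δ, hδ, rfl⟩
  refine ⟨z, γ.trans δ, ?_, by rw [Homotopic.Quotient.mk_trans, T.act_trans]⟩
  rw [Path.trans_range]
  exact union_subset hγ hδ

/-- A set is open when it contains, with each of its points, a sheet over a neighbourhood. -/
instance : TopologicalSpace T.Total where
  IsOpen W := ∀ (x : X) (c : T.fiber x), (⟨x, c⟩ : T.Total) ∈ W →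
    ∃ U, IsOpen U ∧ x ∈ U ∧ sheet c U ⊆ W
  isOpen_univ _ _ _ := ⟨univ, isOpen_univ, mem_univ _, subset_univ _⟩
  isOpen_inter W W' hW hW' x c h := by
    obtain ⟨U, hU, hx, hs⟩ := hW x c h.1
    obtain ⟨U', hU', hx', hs'⟩ := hW' x c h.2
    exact ⟨U ∩ U', hU.inter hU', ⟨hx, hx'⟩, subset_inter
      ((sheet_mono c inter_subset_left).trans hs) ((sheet_mono c inter_subset_right).trans hs')⟩
  isOpen_sUnion S hS x c h := by
    obtain ⟨W, hW, hc⟩ := h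
    obtain ⟨U, hU, hx, hs⟩ := hS W hW x c hc
    exact ⟨U, hU, hx, hs.trans (subset_sUnion_of_mem hW)⟩

theorem isOpen_iff {W : Set T.Total} : IsOpen W ↔ ∀ (x : X) (c : T.fiber x),
    (⟨x, c⟩ : T.Total) ∈ W → ∃ U, IsOpen U ∧ x ∈ U ∧ sheet c U ⊆ W :=
  Iff.rfl

theorem isOpen_sheet {x : X} (c : T.fiber x) {U : Set X} (hU : IsOpen U) :
    IsOpen (sheet c U) := by
  rw [isOpen_iff]
  rintro y d ⟨z, γ, hγ, h⟩
  obtain ⟨rfl, h⟩ := Total.mk.inj h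
  obtain rfl := eq_of_heq h
  exact ⟨U, hU, hγ ⟨1, γ.target⟩, sheet_act_subset c γ hγ⟩

variable (T) in
/-- The projection of the total space to the base. -/
def proj : C(T.Total, X) where
  toFun e := e.base
  continuous_toFun := by
    refine ⟨fun U hU => isOpen_iff.2 fun x c hx => ⟨U, hU, hx, ?_⟩⟩
    rintro _ ⟨y, γ, hγ, rfl⟩
    exact hγ ⟨1, γ.target⟩

theorem isOpenMap_proj [LocallyPathConnectedSpace X] : IsOpenMap T.proj := by
  intro W hW
  rw [isOpen_iff_mem_nhds]
  rintro _ ⟨⟨x, c⟩, he, rfl⟩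
  obtain ⟨U, hU, hx, hs⟩ := isOpen_iff.1 hW x c he
  -- The sheet covers the path component of `x` in `U`, which is open by local path connectedness.
  refine Filter.mem_of_superset
    ((hU.pathComponentIn x).mem_nhds (mem_pathComponentIn_self hx)) ?_
  rintro y ⟨γ, hγ⟩
  exact ⟨⟨y, T.act c (Homotopic.Quotient.mk γ)⟩, hs ⟨y, γ, range_subset_iff.2 hγ, rfl⟩, rfl⟩

variable (T) in
/-- Every point of a fiber is fixed by the loops in some neighbourhood of the base point. -/
def LocallyFixed : Prop :=
  ∀ (x : X) (c : T.fiber x), ∃ U, IsOpen U ∧ x ∈ U ∧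
    ∀ β : Path x x, range β ⊆ U → T.act c (Homotopic.Quotient.mk β) = c

/-- The loop `γ * δ⁻¹` lies in `U`, so it fixes `c`. Hence a sheet over such a `U` meets each fiber
at most once. -/
theorem act_eq_act_of_fixed {x y : X} {c : T.fiber x} {U : Set X}
    (hU : ∀ β : Path x x, range β ⊆ U → T.act c (Homotopic.Quotient.mk β) = c) {γ δ : Path x y}
    (hγ : range γ ⊆ U) (hδ : range δ ⊆ U) :
    T.act c (Homotopic.Quotient.mk γ) = T.act c (Homotopic.Quotient.mk δ) := by
  have h : T.act c (Homotopic.Quotient.mk (γ.trans δ.symm)) = c := by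
    refine hU _ ?_
    rw [Path.trans_range, Path.symm_range]
    exact union_subset hγ hδ
  nth_rw 2 [← h]
  rw [← T.act_trans, Homotopic.Quotient.mk_trans, Homotopic.Quotient.mk_symm, Homotopic.Quotient.trans_assoc,
    Homotopic.Quotient.symm_trans, Homotopic.Quotient.trans_refl]

theorem isLocalHomeomorph_proj [LocallyPathConnectedSpace X] (hT : T.LocallyFixed) :
    IsLocalHomeomorph T.proj := by
  rw [isLocalHomeomorph_iff_isOpenEmbedding_restrict]
  rintro ⟨x, c⟩
  obtain ⟨U, hU, hx, hfix⟩ := hT x c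
  have ho := isOpen_sheet c hU
  refine ⟨sheet c U, ho.mem_nhds (mem_sheet_self c hx),
    .of_continuous_injective_isOpenMap (T.proj.continuous.comp continuous_subtype_val) ?_
      (isOpenMap_proj.comp ho.isOpenMap_subtype_val)⟩
  rintro ⟨_, y, γ, hγ, rfl⟩ ⟨_, z, δ, hδ, rfl⟩ h
  obtain rfl : y = z := h
  exact Subtype.ext (congrArg (Total.mk y) (act_eq_act_of_fixed hfix hγ hδ))

/-! ### Lifting paths to the total space -/

theorem eventually_range_subpath_subset {a b : X} (P : Path a b) (s : I) {U : Set X}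
    (hU : IsOpen U) (hs : P s ∈ U) : ∀ᶠ t in 𝓝 s, range (P.subpath s t) ⊆ U := by
  have h : Filter.Tendsto (fun t : I => uIcc s t) (𝓝 s) (𝓝 s).smallSets :=
    tendsto_const_nhds.uIcc Filter.tendsto_id
  filter_upwards [Filter.tendsto_smallSets_iff.1 h _ ((hU.preimage P.continuous).mem_nhds hs)]
    with t ht
  rw [Path.range_subpath]
  exact image_subset_iff.2 ht

theorem act_subpath_subpath {a b : X} (P : Path a b) {r : I} (c : T.fiber (P r)) (s t : I) :
    T.act (T.act c (Homotopic.Quotient.mk (P.subpath r s))) (Homotopic.Quotient.mk (P.subpath s t)) =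
      T.act c (Homotopic.Quotient.mk (P.subpath r t)) := by
  rw [← T.act_trans, ← Homotopic.Quotient.mk_trans]
  exact congrArg _ (Homotopic.Quotient.eq.2 ⟨Path.Homotopy.subpathTransSubpath P r s t⟩)

theorem act_subpath_self {a b : X} (P : Path a b) {r : I} (c : T.fiber (P r)) :
    T.act c (Homotopic.Quotient.mk (P.subpath r r)) = c := by
  rw [Path.subpath_self, Homotopic.Quotient.mk_refl, T.act_refl]

/-- The continuous lifts of a path are exactly the families obtained by transport along it. -/
theorem continuous_lift_iff (hT : T.LocallyFixed) {a b : X} (P : Path a b)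
    (c : ∀ t, T.fiber (P t)) : Continuous (fun t => (⟨P t, c t⟩ : T.Total)) ↔
      ∀ t, c t = T.act (c 0) (Homotopic.Quotient.mk (P.subpath 0 t)) := by
  constructor
  · intro hc
    -- Near `s` the lift stays in one sheet, where any path inside `U` computes the coordinate, in
    -- particular `P` itself.
    have loc (s : I) : ∀ᶠ t in 𝓝 s, c t = T.act (c s) (Homotopic.Quotient.mk (P.subpath s t)) := by
      obtain ⟨U, hU, hs, hfix⟩ := hT _ (c s)
      filter_upwards [eventually_range_subpath_subset P s hU hs,
        ((isOpen_sheet (c s) hU).preimage hc).mem_nhds (mem_sheet_self (c s) hs)] with t ht ht'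
      obtain ⟨y, δ, hδ, h⟩ := ht'
      obtain ⟨rfl, h⟩ := Total.mk.inj h
      rw [eq_of_heq h]
      exact act_eq_act_of_fixed hfix hδ ht
    -- Transporting every coordinate back to time `0` lands in a single fiber, where connectedness
    -- of `I` applies.
    have hconst : IsLocallyConstant
        fun t => T.act (c t) (Homotopic.Quotient.mk (P.subpath t 0)) := by
      rw [IsLocallyConstant.iff_eventually_eq]
      intro s
      filter_upwards [loc s] with t ht
      rw [ht, act_subpath_subpath]
    intro t
    have h := hconst.apply_eq_of_isPreconnected isPreconnected_univ (mem_univ t) (mem_univ 0)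
    simp only [act_subpath_self] at h
    rw [← h, act_subpath_subpath, act_subpath_self]
  · intro hc
    refine ⟨fun W hW => isOpen_iff_mem_nhds.2 fun s hs => ?_⟩
    obtain ⟨U, hU, hx, hW⟩ := isOpen_iff.1 hW _ _ hs
    filter_upwards [eventually_range_subpath_subset P s hU hx] with t ht
    refine hW ⟨P t, P.subpath s t, ht, ?_⟩
    refine congrArg (Total.mk (P t)) ?_
    rw [hc t, hc s, act_subpath_subpath]

theorem hasUniquePathLifting_proj (hT : T.LocallyFixed) : HasUniquePathLifting T.proj := by
  rintro ⟨x, c⟩ γ h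
  obtain rfl : γ 0 = x := h
  let P : Path (γ 0) (γ 1) := ⟨γ, rfl, rfl⟩
  have hcont := (continuous_lift_iff hT P
    fun t => T.act (x := P 0) c (Homotopic.Quotient.mk (P.subpath 0 t))).2
      fun t => (act_subpath_subpath P (r := 0) c 0 t).symm
  refine ⟨⟨_, hcont⟩, ⟨?_, rfl⟩, ?_⟩
  · exact congrArg (Total.mk (γ 0)) (act_subpath_self P (r := 0) c)
  · rintro Γ ⟨h0, hΓ⟩
    have hex (t : I) : ∃ d : T.fiber (P t), Γ t = ⟨P t, d⟩ := by
      have : (Γ t).base = P t := congrFun hΓ t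
      rw [← this]
      exact ⟨(Γ t).coord, rfl⟩
    choose d hd using hex
    have hdc : Continuous fun t => (⟨P t, d t⟩ : T.Total) := by
      simpa only [← hd] using Γ.continuous
    have hd0 : d 0 = c :=
      eq_of_heq (Total.mk.inj ((hd 0).symm.trans h0)).2
    ext1 t
    rw [hd t, (continuous_lift_iff hT P d).1 hdc t, hd0]
    rfl

/-- Absorbs the endpoint equalities `Γ 0 = e` and `Γ 1 = e'`, which change the fiber types. -/
theorem act_of_act_cast {e e' f f' : T.Total} (h : f = e) (h' : f' = e')
    (q : Homotopic.Quotient e.base e'.base)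
    (H : T.act f.coord (q.cast (congrArg Total.base h) (congrArg Total.base h')) = f'.coord) :
    T.act e.coord q = e'.coord := by
  subst h h'
  simpa using H

theorem act_map_proj (hT : T.LocallyFixed) {e e' : T.Total} (Γ : Path e e') :
    T.act e.coord (Homotopic.Quotient.mk (Γ.map T.proj.continuous)) = e'.coord := by
  have h := (continuous_lift_iff hT (Γ.map T.proj.continuous) fun t => (Γ t).coord).1 Γ.continuous 1
  rw [Path.subpath_zero_one, Homotopic.Quotient.mk_cast] at h
  exact act_of_act_cast Γ.source Γ.target _ h.symm

theorem exists_lift (hT : T.LocallyFixed) {x y : X} (c : T.fiber x) (γ : Path x y) :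
    ∃ Γ : Path (⟨x, c⟩ : T.Total) ⟨y, T.act c (Homotopic.Quotient.mk γ)⟩,
      Γ.map T.proj.continuous = γ := by
  obtain ⟨Γ, ⟨h0, hΓ⟩, -⟩ := hasUniquePathLifting_proj hT (⟨x, c⟩ : T.Total) γ γ.source
  obtain ⟨d, hd⟩ : ∃ d : T.fiber y, Γ 1 = ⟨y, d⟩ := by
    have : (Γ 1).base = y := (congrFun hΓ 1).trans γ.target
    rw [← this]
    exact ⟨(Γ 1).coord, rfl⟩
  let Γ' : Path (⟨x, c⟩ : T.Total) ⟨y, d⟩ := ⟨Γ, h0, hd⟩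
  have hmap : Γ'.map T.proj.continuous = γ := Path.ext hΓ
  obtain rfl : T.act c (Homotopic.Quotient.mk γ) = d :=
    (congrArg (fun δ => T.act c (Homotopic.Quotient.mk δ)) hmap).symm.trans (act_map_proj hT Γ')
  exact ⟨Γ', hmap⟩

/-- The image of the fundamental group of the total space is the stabilizer of the base point. -/
theorem mem_range_mapOfEq_proj_iff (hT : T.LocallyFixed) {x : X} (c : T.fiber x)
    (g : FundamentalGroup X x) :
    g ∈ (FundamentalGroup.mapOfEq T.proj (x := (⟨x, c⟩ : T.Total)) (y := x) rfl).range ↔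
      T.act c g.toPath = c := by
  constructor
  · rintro ⟨q, rfl⟩
    refine (congrArg (T.act c) (FundamentalGroup.mapOfEq_apply T.proj rfl q)).trans ?_
    induction q using Homotopic.Quotient.ind with
    | mk Γ => exact act_map_proj hT Γ
  · intro h
    obtain ⟨γ, rfl⟩ := Homotopic.Quotient.mk_surjective g
    obtain ⟨Γ, hΓ⟩ := exists_lift hT c γ
    refine ⟨FundamentalGroup.fromPath (Homotopic.Quotient.mk (Γ.cast rfl (congrArg (Total.mk x) h.symm))), ?_⟩
    exact (FundamentalGroup.mapOfEq_apply T.proj rfl _).trans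
      (congrArg Homotopic.Quotient.mk hΓ)

theorem isSemicoveringMap_proj [LocallyPathConnectedSpace X] (hT : T.LocallyFixed)
    (hne : ∀ x, Nonempty (T.fiber x)) : IsSemicoveringMap T.proj where
  surjective x := (hne x).elim fun c => ⟨⟨x, c⟩, rfl⟩
  isLocalHomeomorph := isLocalHomeomorph_proj hT
  uniquePathLifting := hasUniquePathLifting_proj hT

end PathTransport

/-! ### The transport on cosets of a subgroup of the fundamental group -/

section Cosets

variable {X : Type u} [TopologicalSpace X] {x₀ : X}

theorem Path.Homotopic.Quotient.symm_of_trans {x y z : X} (p : Homotopic.Quotient x y)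
    (q : Homotopic.Quotient y z) : (p.trans q).symm = q.symm.trans p.symm := by
  induction p using Homotopic.Quotient.ind with | mk p =>
  induction q using Homotopic.Quotient.ind with | mk q =>
  rw [← Homotopic.Quotient.mk_trans, ← Homotopic.Quotient.mk_symm, Path.trans_symm]
  rfl

theorem Path.Homotopic.Quotient.symm_of_symm {x y : X} (p : Homotopic.Quotient x y) :
    p.symm.symm = p := by
  induction p using Homotopic.Quotient.ind with | mk p =>
  rw [← Homotopic.Quotient.mk_symm, ← Homotopic.Quotient.mk_symm, Path.symm_symm]

/-- A set of classes of paths from `x₀` to `x` is an `H`-coset if it is a class of the relation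
`[α * β⁻¹] ∈ H`; over points that are not joined to `x₀`, the empty set is allowed. -/
def IsPathCoset (H : Subgroup (FundamentalGroup X x₀)) {x : X}
    (A : Set (Homotopic.Quotient x₀ x)) : Prop :=
  (∀ f ∈ A, ∀ g, g ∈ A ↔ FundamentalGroup.fromPath (g.trans f.symm) ∈ H) ∧
    (Nonempty (Homotopic.Quotient x₀ x) → A.Nonempty)

theorem IsPathCoset.transport {H : Subgroup (FundamentalGroup X x₀)} {x y : X}
    {A : Set (Homotopic.Quotient x₀ x)} (hA : IsPathCoset H A)
    (q : Homotopic.Quotient x y) : IsPathCoset H {f | f.trans q.symm ∈ A} := by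
  refine ⟨fun f hf g => ?_, fun ⟨f⟩ => ?_⟩
  · change g.trans q.symm ∈ A ↔ _
    rw [hA.1 _ hf, Homotopic.Quotient.symm_of_trans, Homotopic.Quotient.symm_of_symm, Homotopic.Quotient.trans_assoc,
      ← Homotopic.Quotient.trans_assoc q.symm, Homotopic.Quotient.symm_trans, Homotopic.Quotient.refl_trans]
  · obtain ⟨a, ha⟩ := hA.2 ⟨f.trans q.symm⟩
    refine ⟨a.trans q, ?_⟩
    change (a.trans q).trans q.symm ∈ A
    rwa [Homotopic.Quotient.trans_assoc, Homotopic.Quotient.trans_symm, Homotopic.Quotient.trans_refl]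

/-- The transport whose fibers are the `H`-cosets of classes of paths starting at `x₀`. -/
def cosetTransport (H : Subgroup (FundamentalGroup X x₀)) : PathTransport X where
  fiber x := {A : Set (Homotopic.Quotient x₀ x) // IsPathCoset H A}
  act A q := ⟨_, A.2.transport q⟩
  act_refl {x} A := by
    have h : (Homotopic.Quotient.refl x).symm = Homotopic.Quotient.refl x := by
      rw [← Homotopic.Quotient.mk_refl, ← Homotopic.Quotient.mk_symm, Path.refl_symm]
    ext f
    change f.trans (Homotopic.Quotient.refl x).symm ∈ A.1 ↔ _
    rw [h, Homotopic.Quotient.trans_refl]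
  act_trans A p q := by
    ext f
    change f.trans (p.trans q).symm ∈ A.1 ↔ (f.trans q.symm).trans p.symm ∈ A.1
    rw [Homotopic.Quotient.symm_of_trans, Homotopic.Quotient.trans_assoc]

/-- The subgroup itself, as a point of the fiber over `x₀`. -/
def cosetBase (H : Subgroup (FundamentalGroup X x₀)) : (cosetTransport H).fiber x₀ :=
  ⟨{f | FundamentalGroup.fromPath f ∈ H},
    fun f hf _ => (H.mul_mem_cancel_left
      (H.inv_mem (x := FundamentalGroup.fromPath f) hf)).symm, fun _ => ⟨_, H.one_mem⟩⟩

theorem cosetTransport_act_base_iff (H : Subgroup (FundamentalGroup X x₀))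
    (g : FundamentalGroup X x₀) :
    (cosetTransport H).act (cosetBase H) g.toPath = cosetBase H ↔ g ∈ H := by
  -- Multiplication is reversed concatenation, so `f` followed by the inverse of `g` is `g⁻¹ * f`.
  have key (f : FundamentalGroup X x₀) :
      f.toPath ∈ ((cosetTransport H).act (cosetBase H) g.toPath).1 ↔ g⁻¹ * f ∈ H := Iff.rfl
  constructor
  · intro h
    have hg := key g
    rw [h, inv_mul_cancel] at hg
    exact hg.2 H.one_mem
  · intro hg
    refine Subtype.ext (Set.ext fun f => ?_)
    exact (key f).trans (H.mul_mem_cancel_left (H.inv_mem hg))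

theorem nonempty_cosetTransport_fiber (H : Subgroup (FundamentalGroup X x₀)) (x : X) :
    Nonempty ((cosetTransport H).fiber x) := by
  by_cases h : Nonempty (Homotopic.Quotient x₀ x)
  · exact h.map fun q => (cosetTransport H).act (cosetBase H) q
  · exact ⟨∅, fun _ hf => hf.elim, fun h' => (h h').elim⟩

theorem conj_mem_pathSpanierSubgroup (V : PathOpenCover X x₀) {x : X} (α : Path x₀ x)
    (β : Path x x) (hβ : range β ⊆ V.nhd α) :
    FundamentalGroup.fromPath (Homotopic.Quotient.mk ((α.trans β).trans α.symm)) ∈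
      pathSpanierSubgroup V :=
  Subgroup.subset_closure ⟨x, α, β, hβ, rfl⟩

/-- For any representative `α` of the coset, `V_α` works: `f * β⁻¹ * α⁻¹` followed by `α * β * α⁻¹ ∈
H` is `f * α⁻¹`. -/
theorem cosetTransport_locallyFixed {H : Subgroup (FundamentalGroup X x₀)}
    {V : PathOpenCover X x₀} (hV : pathSpanierSubgroup V ≤ H) :
    (cosetTransport H).LocallyFixed := by
  rintro x ⟨A, hA⟩
  by_cases hne : Nonempty (Homotopic.Quotient x₀ x)
  · obtain ⟨a, ha⟩ := hA.2 hne
    obtain ⟨α, rfl⟩ := Homotopic.Quotient.mk_surjective a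
    refine ⟨V.nhd α, V.isOpen_nhd α, V.endpoint_mem α, fun β hβ =>
      Subtype.ext (Set.ext fun f => ?_)⟩
    have hk := hV (conj_mem_pathSpanierSubgroup V α β hβ)
    rw [Homotopic.Quotient.mk_trans, Homotopic.Quotient.mk_trans, Homotopic.Quotient.mk_symm] at hk
    change f.trans (Homotopic.Quotient.mk β).symm ∈ A ↔ f ∈ A
    rw [hA.1 _ ha, hA.1 _ ha f, ← H.mul_mem_cancel_left hk, FundamentalGroup.mul_def]
    refine iff_of_eq (congrArg (· ∈ H) ?_)
    generalize Homotopic.Quotient.mk α = a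
    generalize Homotopic.Quotient.mk β = b
    change ((f.trans b.symm).trans a.symm).trans ((a.trans b).trans a.symm) = f.trans a.symm
    rw [Homotopic.Quotient.trans_assoc a b, Homotopic.Quotient.trans_assoc (f.trans b.symm),
      ← Homotopic.Quotient.trans_assoc a.symm a, Homotopic.Quotient.symm_trans, Homotopic.Quotient.refl_trans,
      Homotopic.Quotient.trans_assoc f, ← Homotopic.Quotient.trans_assoc b.symm, Homotopic.Quotient.symm_trans,
      Homotopic.Quotient.refl_trans]
  · exact ⟨univ, isOpen_univ, mem_univ x, fun β _ =>
      Subtype.ext (Set.ext fun f => (hne ⟨f⟩).elim)⟩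

theorem isSemicoveringSubgroup_of_pathSpanierSubgroup_le [LocallyPathConnectedSpace X]
    {H : Subgroup (FundamentalGroup X x₀)} {V : PathOpenCover X x₀}
    (hV : pathSpanierSubgroup V ≤ H) : IsSemicoveringSubgroup H := by
  have hT := cosetTransport_locallyFixed hV
  refine ⟨(cosetTransport H).Total, inferInstance, (cosetTransport H).proj, ⟨x₀, cosetBase H⟩,
    rfl, PathTransport.isSemicoveringMap_proj hT (nonempty_cosetTransport_fiber H), ?_⟩
  ext g
  rw [PathTransport.mem_range_mapOfEq_proj_iff hT, cosetTransport_act_base_iff]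

/-! ### Semicovering subgroups contain path Spanier subgroups -/

theorem conj_mem_range_mapOfEq {E : Type u} [TopologicalSpace E] (p : C(E, X)) {e₀ e : E} {x : X}
    (A : Path e₀ e) (B : Path e e) (h : p e = x) {α : Path (p e₀) x} {β : Path x x}
    (hA : (A.map p.continuous).cast rfl h.symm = α)
    (hB : (B.map p.continuous).cast h.symm h.symm = β) :
    FundamentalGroup.fromPath (Homotopic.Quotient.mk ((α.trans β).trans α.symm)) ∈
      (FundamentalGroup.mapOfEq p (rfl : p e₀ = p e₀)).range := by
  subst h hA hB
  refine ⟨FundamentalGroup.fromPath (Homotopic.Quotient.mk ((A.trans B).trans A.symm)), ?_⟩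
  rw [FundamentalGroup.mapOfEq_apply]
  refine congrArg Homotopic.Quotient.mk
    (a₁ := ((A.trans B).trans A.symm).map p.continuous) ?_
  rw [Path.map_trans, Path.map_trans]
  rfl

theorem IsSemicoveringSubgroup.exists_pathSpanierSubgroup_le
    {H : Subgroup (FundamentalGroup X x₀)} (hH : IsSemicoveringSubgroup H) :
    ∃ V : PathOpenCover X x₀, pathSpanierSubgroup V ≤ H := by
  obtain ⟨E, _, p, e₀, rfl, hp, rfl⟩ := hH
  have lift {x : X} (α : Path (p e₀) x) : ∃ (e : E) (h : p e = x) (A : Path e₀ e),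
      (A.map p.continuous).cast rfl h.symm = α := by
    obtain ⟨A, ⟨h0, hA⟩, -⟩ := hp.uniquePathLifting e₀ α α.source
    exact ⟨A 1, (congrFun hA 1).trans α.target, ⟨A, h0, rfl⟩, Path.ext hA⟩
  choose e he A hA using @lift
  choose φ hφ hpφ using hp.isLocalHomeomorph
  refine ⟨⟨fun α => (φ (e α)).target, fun α => (φ (e α)).open_target, fun α => ?_⟩, ?_⟩
  · have h := (φ (e α)).map_source (hφ _)
    rwa [← hpφ, he] at h
  · refine (Subgroup.closure_le _).2 ?_
    rintro _ ⟨x, α, β, hβ, rfl⟩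
    have hmem (t : I) : β t ∈ (φ (e α)).target := hβ ⟨t, rfl⟩
    have hx : (φ (e α)).symm x = e α := by
      have h := (φ (e α)).left_inv (hφ _)
      rwa [← hpφ, he] at h
    -- The local inverse sends `x` to `e α`, so this lift of `β` closes up.
    let B : Path (e α) (e α) :=
      { toFun := fun t => (φ (e α)).symm (β t)
        continuous_toFun := (φ (e α)).continuousOn_symm.comp_continuous β.continuous hmem
        source' := by rw [β.source, hx]
        target' := by rw [β.target, hx] }
    have hB : (B.map p.continuous).cast (he α).symm (he α).symm = β := by
      ext t
      change p ((φ (e α)).symm (β t)) = β t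
      rw [hpφ (e α)]
      exact (φ (e α)).right_inv (hmem t)
    exact conj_mem_range_mapOfEq p (A α) B (he α) (hA α) hB

/-! ### Open subgroups of the path Spanier topology -/

theorem mem_concatLeftCoset_iff {g q : FundamentalGroup X x₀}
    {S : Subgroup (FundamentalGroup X x₀)} : q ∈ concatLeftCoset g S ↔ q * g⁻¹ ∈ S := by
  constructor
  · rintro ⟨s, hs, rfl⟩
    change s * g * g⁻¹ ∈ S
    rwa [mul_inv_cancel_right]
  · intro h
    exact ⟨_, h, (inv_mul_cancel_right q g).symm⟩

theorem PathOpenCover.exists_concatLeftCoset_subset {W : Set (FundamentalGroup X x₀)}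
    (hW : IsOpen[pathSpanierTopology X x₀] W) {g : FundamentalGroup X x₀} (hg : g ∈ W) :
    ∃ V : PathOpenCover X x₀, concatLeftCoset g (pathSpanierSubgroup V) ⊆ W := by
  induction hW with
  | basic B hB =>
    obtain ⟨k, _, ⟨V, rfl⟩, rfl⟩ := hB
    -- A coset containing `g` is the coset of `g`, so the same cover serves.
    refine ⟨V, fun q hq => ?_⟩
    rw [mem_concatLeftCoset_iff] at *
    have h := mul_mem hq hg
    rwa [← mul_assoc, inv_mul_cancel_right] at h
  | univ => exact ⟨⟨fun _ => univ, fun _ => isOpen_univ, fun _ => mem_univ _⟩, subset_univ _⟩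
  | inter s t _ _ ihs iht =>
    obtain ⟨V, hV⟩ := ihs hg.1
    obtain ⟨V', hV'⟩ := iht hg.2
    refine ⟨⟨fun α => V.nhd α ∩ V'.nhd α, fun α => (V.isOpen_nhd α).inter (V'.isOpen_nhd α),
      fun α => ⟨V.endpoint_mem α, V'.endpoint_mem α⟩⟩, fun q hq => ⟨hV ?_, hV' ?_⟩⟩ <;>
    rw [mem_concatLeftCoset_iff] at * <;>
    refine (Subgroup.closure_mono ?_) hq <;>
    rintro _ ⟨x, α, β, hβ, rfl⟩
    · exact ⟨x, α, β, hβ.trans inter_subset_left, rfl⟩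
    · exact ⟨x, α, β, hβ.trans inter_subset_right, rfl⟩
  | sUnion S _ ih =>
    obtain ⟨s, hs, hgs⟩ := hg
    obtain ⟨V, hV⟩ := ih s hs hgs
    exact ⟨V, hV.trans (subset_sUnion_of_mem hs)⟩

theorem isOpen_pathSpanierTopology_iff {H : Subgroup (FundamentalGroup X x₀)} :
    IsOpen[pathSpanierTopology X x₀] (H : Set (FundamentalGroup X x₀)) ↔
      ∃ V : PathOpenCover X x₀, pathSpanierSubgroup V ≤ H := by
  constructor
  · intro h
    obtain ⟨V, hV⟩ := PathOpenCover.exists_concatLeftCoset_subset h H.one_mem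
    exact ⟨V, fun s hs => hV (mem_concatLeftCoset_iff.2 (by rwa [inv_one, mul_one s]))⟩
  · rintro ⟨V, hV⟩
    let := pathSpanierTopology X x₀
    refine isOpen_iff_forall_mem_open.2 fun g hg =>
      ⟨concatLeftCoset g (pathSpanierSubgroup V), fun q hq => ?_,
        .basic _ ⟨g, _, ⟨V, rfl⟩, rfl⟩, mem_concatLeftCoset_iff.2 ?_⟩
    · have h := mul_mem (hV (mem_concatLeftCoset_iff.1 hq)) hg
      rwa [inv_mul_cancel_right] at h
    · rw [mul_inv_cancel]
      exact one_mem _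

end Cosets

theorem mainTheorem4 {X : Type u} [TopologicalSpace X] [LocallyPathConnectedSpace X] (x₀ : X)
    (H : Subgroup (FundamentalGroup X x₀)) :
    IsSemicoveringSubgroup H ↔
      IsOpen[pathSpanierTopology X x₀] (H : Set (FundamentalGroup X x₀)) :=
  ⟨fun h => isOpen_pathSpanierTopology_iff.2 h.exists_pathSpanierSubgroup_le, fun h =>
    (isOpen_pathSpanierTopology_iff.1 h).elim
      fun _ hV => isSemicoveringSubgroup_of_pathSpanierSubgroup_le hV⟩
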